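/- Let $\mathsf{Atm}$ be a countable set of propositional variables and let formulas be given in negation normal form by $A ::= p \mid \bar p \mid A\wedge A \mid A\vee A \mid \Box A \mid \Diamond A$ ($p\in\mathsf{Atm}$), with $\bar A$ defined by de Morgan duality and $A\supset B := \bar A\vee B$. For $X\subseteq\{n\in\mathbb N : n>1\}$ let $\mathsf K+\mathsf 4^X$ be the Hilbert system consisting of classical propositional logic, the axiom schema $\Box(A\supset B)\supset(\Box A\supset\Box B)$, the axiom schemas $\Diamond^nA\supset\Diamond A$ for $n\in X$, modus ponens, and necessitation (from $A$ infer $\Box A$). A nested sequent is a finite multiset of formulas and of boxed sequents $[\Gamma]$, where $\Gamma$ is a nested sequent. A context $\Gamma\{\ \}$ is a nested sequent with one hole, which stands in the place of a formula (possibly inside boxed sequents, but not inside a formula), and $\Gamma\{\Delta\}$ is the result of putting $\Delta$ into the hole. The system $\mathsf{nK}$ has the axioms $\Gamma\{p,\bar p\}$ ($p \in \mathsf{Atm}$) and the rules $$\frac{\Gamma\{A,B\}}{\Gamma\{A\vee B\}}\qquad \frac{\Gamma\{A\}\quad\Gamma\{B\}}{\Gamma\{A\wedge B\}}\qquad \frac{\Gamma\{[A]\}}{\Gamma\{\Box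 A\}}\qquad \frac{\Gamma\{\Diamond A,[A,\Delta]\}}{\Gamma\{\Diamond A,[\Delta]\}}.$$ For $n>1$ the rule $\Diamond_{\mathsf 4n}$ is $$\frac{\Gamma\{\Diamond A,[\Delta_1,[\dots,[\Delta_{n-2},[\Diamond A,\Delta_{n-1}]]\dots]]\}}{\Gamma\{\Diamond A,[\Delta_1,[\dots,[\Delta_{n-2},[\Delta_{n-1}]]\dots]]\}},$$ and $\Diamond_{\mathsf 4X}:=\{\Diamond_{\mathsf 4n}: n\in X\}$. Theorem. Let $X\subseteq\{n\in\mathbb N: n>1\}$ and let $A$ be a formula. Then $\mathsf K+\mathsf 4^X\vdash A$ if and only if $\mathsf{nK}+\Diamond_{\mathsf 4X}\vdash A$, that is, the nested sequent consisting of the single formula $A$ has a (cut-free) proof in $\mathsf{nK}+\Diamond_{\mathsf 4X}$. -/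

import Mathlib

namespace QuasiTrans

/-- Modal formulas in negation normal form over a set `Atm` of propositional variables. -/
inductive Formula (Atm : Type*) where
  | atom (p : Atm) : Formula Atm
  | natom (p : Atm) : Formula Atm
  | and (A B : Formula Atm) : Formula Atm
  | or (A B : Formula Atm) : Formula Atm
  | box (A : Formula Atm) : Formula Atm
  | dia (A : Formula Atm) : Formula Atm

namespace Formula

variable {Atm : Type*}

/-- Negation, by de Morgan duality. -/
def neg : Formula Atm → Formula Atm
  | atom p => natom p
  | natom p => atom p
  | and A B => or (neg A) (neg B)
  | or A B => and (neg A) (neg B)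
  | box A => dia (neg A)
  | dia A => box (neg A)

/-- Implication `A ⊃ B`, defined as `Ā ∨ B`. -/
def imp (A B : Formula Atm) : Formula Atm := or (neg A) B

/-- `◇ⁿ A`. -/
def diaPow : ℕ → Formula Atm → Formula Atm
  | 0, A => A
  | n + 1, A => dia (diaPow n A)

/-- Truth of a formula under a Boolean assignment `v` of its propositional constituents: the
variables and the formulas `□ B` are assigned truth values freely, and `◇ B` is read as the
negation of `□ B̄`. -/
def boolEval (v : Formula Atm → Prop) : Formula Atm → Prop
  | atom p => v (atom p)
  | natom p => ¬ v (atom p)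
  | and A B => boolEval v A ∧ boolEval v B
  | or A B => boolEval v A ∨ boolEval v B
  | box A => v (box A)
  | dia A => ¬ v (box (neg A))

/-- `A` is (a substitution instance of) a classical propositional tautology. -/
def Tautology (A : Formula Atm) : Prop := ∀ v : Formula Atm → Prop, boolEval v A

end Formula

/-- Theoremhood in the Hilbert system `K + Ax`: classical propositional logic, the schema
`k : □(A ⊃ B) ⊃ (□A ⊃ □B)`, the additional axioms `Ax`, modus ponens and necessitation. -/
inductive KTheorem {Atm : Type*} (Ax : Set (Formula Atm)) : Formula Atm → Prop
  | taut {A : Formula Atm} : A.Tautology → KTheorem Ax A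
  | k (A B : Formula Atm) : KTheorem Ax ((A.imp B).box.imp (A.box.imp B.box))
  | ax {A : Formula Atm} : A ∈ Ax → KTheorem Ax A
  | mp {A B : Formula Atm} : KTheorem Ax (A.imp B) → KTheorem Ax A → KTheorem Ax B
  | nec {A : Formula Atm} : KTheorem Ax A → KTheorem Ax A.box

/-- The quasi-transitivity axioms `4ⁿ : ◇ⁿ A ⊃ ◇ A` for `n ∈ X` (all instances of the schemas). -/
def quasiTransAxioms (Atm : Type*) (X : Set ℕ) : Set (Formula Atm) :=
  {F | ∃ n ∈ X, ∃ A : Formula Atm, F = (A.diaPow n).imp A.dia}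

/-- Ordered representatives of nested sequents: `Γ ::= ∅ | A, Γ | [Δ], Γ`. -/
inductive PreSequent (Atm : Type*) where
  | nil : PreSequent Atm
  | consFormula (A : Formula Atm) (Γ : PreSequent Atm) : PreSequent Atm
  | consBox (Δ Γ : PreSequent Atm) : PreSequent Atm

namespace PreSequent

variable {Atm : Type*}

/-- Equality up to the order of the elements, at every level of nesting. -/
inductive Equiv : PreSequent Atm → PreSequent Atm → Prop
  | refl (Γ : PreSequent Atm) : Equiv Γ Γ
  | symm {Γ Γ' : PreSequent Atm} : Equiv Γ Γ' → Equiv Γ' Γ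
  | trans {Γ Γ' Γ'' : PreSequent Atm} : Equiv Γ Γ' → Equiv Γ' Γ'' → Equiv Γ Γ''
  | consFormula (A : Formula Atm) {Γ Γ' : PreSequent Atm} :
      Equiv Γ Γ' → Equiv (.consFormula A Γ) (.consFormula A Γ')
  | consBox {Δ Δ' Γ Γ' : PreSequent Atm} :
      Equiv Δ Δ' → Equiv Γ Γ' → Equiv (.consBox Δ Γ) (.consBox Δ' Γ')
  | swapFormulas (A B : Formula Atm) (Γ : PreSequent Atm) :
      Equiv (.consFormula A (.consFormula B Γ)) (.consFormula B (.consFormula A Γ))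
  | swapFormulaBox (A : Formula Atm) (Δ Γ : PreSequent Atm) :
      Equiv (.consFormula A (.consBox Δ Γ)) (.consBox Δ (.consFormula A Γ))
  | swapBoxes (Δ Δ' Γ : PreSequent Atm) :
      Equiv (.consBox Δ (.consBox Δ' Γ)) (.consBox Δ' (.consBox Δ Γ))

instance setoid (Atm : Type*) : Setoid (PreSequent Atm) where
  r := Equiv
  iseqv := ⟨Equiv.refl, Equiv.symm, Equiv.trans⟩

/-- Concatenation. -/
def append : PreSequent Atm → PreSequent Atm → PreSequent Atm
  | nil, Θ => Θ
  | consFormula A Γ, Θ => consFormula A (append Γ Θ)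
  | consBox Δ Γ, Θ => consBox Δ (append Γ Θ)

theorem append_equiv_right (Γ : PreSequent Atm) {Θ Θ' : PreSequent Atm} (h : Equiv Θ Θ') :
    Equiv (append Γ Θ) (append Γ Θ') := by
  induction Γ with
  | nil => exact h
  | consFormula A Γ ih => exact .consFormula A ih
  | consBox Δ Γ _ ih => exact .consBox (.refl Δ) ih

theorem append_equiv_left {Γ Γ' : PreSequent Atm} (h : Equiv Γ Γ') (Θ : PreSequent Atm) :
    Equiv (append Γ Θ) (append Γ' Θ) := by
  induction h with
  | refl Γ => exact .refl _
  | symm _ ih => exact .symm ih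
  | trans _ _ ih₁ ih₂ => exact .trans ih₁ ih₂
  | consFormula A _ ih => exact .consFormula A ih
  | consBox h _ _ ih => exact .consBox h ih
  | swapFormulas A B Γ => exact .swapFormulas A B _
  | swapFormulaBox A Δ Γ => exact .swapFormulaBox A Δ _
  | swapBoxes Δ Δ' Γ => exact .swapBoxes Δ Δ' _

end PreSequent

/-- Nested sequents: finite multisets of formulas and boxed nested sequents. -/
def NSequent (Atm : Type*) : Type _ := Quotient (PreSequent.setoid Atm)

namespace NSequent

variable {Atm : Type*}

/-- The empty sequent. -/
def empty : NSequent Atm := Quotient.mk _ .nil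

instance : Zero (NSequent Atm) := ⟨empty⟩

/-- Multiset union, written `Γ, Δ` on paper and `Γ + Δ` here. -/
def union : NSequent Atm → NSequent Atm → NSequent Atm :=
  Quotient.map₂ PreSequent.append fun _ Γ' h _ _ h' =>
    (PreSequent.append_equiv_left h _).trans (PreSequent.append_equiv_right Γ' h')

instance : Add (NSequent Atm) := ⟨union⟩

/-- The sequent whose only element is the formula `A`. -/
def ofFormula (A : Formula Atm) : NSequent Atm := Quotient.mk _ (.consFormula A .nil)

/-- The sequent `[Δ]`, whose only element is the boxed sequent `[Δ]`. -/
def boxed : NSequent Atm → NSequent Atm :=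
  Quotient.map (fun Δ => .consBox Δ .nil) fun _ _ h => .consBox h (.refl _)

/-- `[Δ₁, [Δ₂, [… [Δₘ, Θ] …]]]` for the list `Δ₁, …, Δₘ`. -/
def chain : List (NSequent Atm) → NSequent Atm → NSequent Atm
  | [], Θ => Θ
  | Δ :: Δs, Θ => boxed (Δ + chain Δs Θ)

end NSequent

/-- Contexts with one hole: either `Γ, { }` or `Γ, [C{ }]`. -/
inductive Context (Atm : Type*) where
  | hole (Γ : NSequent Atm) : Context Atm
  | nest (Γ : NSequent Atm) (C : Context Atm) : Context Atm

/-- Replacing the hole of a context by a sequent. -/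
def Context.fill {Atm : Type*} : Context Atm → NSequent Atm → NSequent Atm
  | .hole Γ, Θ => Γ + Θ
  | .nest Γ C, Θ => Γ + NSequent.boxed (C.fill Θ)

/-- A nested sequent system, given by its rule instances (list of premises, conclusion). -/
abbrev System (Atm : Type*) := Set (List (NSequent Atm) × NSequent Atm)

/-- Provability: there is a finite tree built from instances of the rules of the system. -/
inductive Provable {Atm : Type*} (S : System Atm) : NSequent Atm → Prop
  | infer {Ps : List (NSequent Atm)} {Γ : NSequent Atm} :
      (Ps, Γ) ∈ S → (∀ P ∈ Ps, Provable S P) → Provable S Γ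

open NSequent in
/-- The rule instances of the system `nK`. -/
inductive NKRule {Atm : Type*} : List (NSequent Atm) → NSequent Atm → Prop
  | id (C : Context Atm) (p : Atm) :
      NKRule [] (C.fill (ofFormula (.atom p) + ofFormula (.natom p)))
  | or (C : Context Atm) (A B : Formula Atm) :
      NKRule [C.fill (ofFormula A + ofFormula B)] (C.fill (ofFormula (.or A B)))
  | and (C : Context Atm) (A B : Formula Atm) :
      NKRule [C.fill (ofFormula A), C.fill (ofFormula B)] (C.fill (ofFormula (.and A B)))
  | box (C : Context Atm) (A : Formula Atm) :
      NKRule [C.fill (boxed (ofFormula A))] (C.fill (ofFormula (.box A)))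
  | dia (C : Context Atm) (A : Formula Atm) (Δ : NSequent Atm) :
      NKRule [C.fill (ofFormula (.dia A) + boxed (ofFormula A + Δ))]
        (C.fill (ofFormula (.dia A) + boxed Δ))

/-- The system `nK`. -/
def nK (Atm : Type*) : System Atm := {r | NKRule r.1 r.2}

open NSequent in
/-- The instances of the rule `◇₄ₙ` (for `n > 1`), with premise
`C{◇A, [Δ₁, [… [Δₙ₋₂, [◇A, Δₙ₋₁]] …]]}` and conclusion `C{◇A, [Δ₁, [… [Δₙ₋₂, [Δₙ₋₁]] …]]}`. -/
def dia4 (Atm : Type*) (n : ℕ) : System Atm :=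
  {r | ∃ (C : Context Atm) (A : Formula Atm) (Δs : List (NSequent Atm)), Δs.length + 1 = n ∧
    r = ([C.fill (ofFormula (.dia A) + chain Δs (ofFormula (.dia A)))],
      C.fill (ofFormula (.dia A) + chain Δs 0))}

/-- The rules `◇₄ₙ` for `n ∈ X`. -/
def dia4Set (Atm : Type*) (X : Set ℕ) : System Atm := ⋃ n ∈ X, dia4 Atm n

end QuasiTrans

/-! From right to left, a nested sequent is read as a formula: elements are joined by ∨, and [Δ]
becomes □ of the reading of Δ. Every rule then preserves Hilbert provability. Contexts are monotone
for this reading (`Context.kTheorem_fill_imp₂`), and ◇₄ₙ reduces to its axiom, since □(A ∨ B) ⊃ ◇A ∨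
□B moves a formula ◇A lying n-1 boxes deep to the outside as ◇ⁿA (`toFormula_chain`).

From left to right there is no syntactic cut elimination; the argument is semantic. Theorems of the
Hilbert system hold in every frame with Rⁿ ⊆ R for n ∈ X (`KTheorem.forces`). If the sequent A is
unprovable, a countermodel of this kind is built. Reading rules upwards extends any unprovable tree
to an unprovable one that meets a given demand (`exists_decomposed`, `exists_propagated`). The
demands are countably many, so a generic ideal of unprovable trees meets them all
(`exists_ideal_answering`), and its union is a saturated labelled tree.

On that tree w accesses wv when |v| - 1 is a sum of numbers n - 1 with n ∈ X. These sums are closed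
under addition, which gives the frame conditions; and ◇₄ₙ carries ◇A down exactly n - 1 levels, so
repeated use followed by one ◇ step sends A to every accessible world. Hence every formula of the
saturated set is false at its label (`Saturated.not_forces`). -/

namespace QuasiTrans

variable {Atm : Type*}

/-! ### Nested sequents as a commutative monoid. -/

namespace PreSequent

theorem append_nil (Γ : PreSequent Atm) : append Γ nil = Γ := by
  induction Γ <;> simp_all [append]

theorem append_assoc (Γ Δ Θ : PreSequent Atm) :
    append (append Γ Δ) Θ = append Γ (append Δ Θ) := by
  induction Γ <;> simp_all [append]

theorem append_consFormula_equiv (Γ Δ : PreSequent Atm) (A : Formula Atm) :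
    Equiv (append Γ (consFormula A Δ)) (consFormula A (append Γ Δ)) := by
  induction Γ with
  | nil => exact .refl _
  | consFormula B Γ ih => exact (Equiv.consFormula B ih).trans (.swapFormulas _ _ _)
  | consBox Θ Γ _ ih => exact (Equiv.consBox (.refl Θ) ih).trans (.symm (.swapFormulaBox _ _ _))

theorem append_consBox_equiv (Γ Δ Θ : PreSequent Atm) :
    Equiv (append Γ (consBox Θ Δ)) (consBox Θ (append Γ Δ)) := by
  induction Γ with
  | nil => exact .refl _
  | consFormula B Γ ih => exact (Equiv.consFormula B ih).trans (.swapFormulaBox _ _ _)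
  | consBox Λ Γ _ ih => exact (Equiv.consBox (.refl Λ) ih).trans (.swapBoxes _ _ _)

theorem append_comm_equiv (Γ Δ : PreSequent Atm) : Equiv (append Γ Δ) (append Δ Γ) := by
  induction Γ with
  | nil => rw [append_nil]; exact .refl _
  | consFormula B Γ ih =>
    exact (Equiv.consFormula B ih).trans (.symm (append_consFormula_equiv _ _ _))
  | consBox Λ Γ _ ih =>
    exact (Equiv.consBox (.refl Λ) ih).trans (.symm (append_consBox_equiv _ _ _))

end PreSequent

namespace NSequent

instance : AddCommMonoid (NSequent Atm) where
  add_assoc := by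
    rintro ⟨Γ⟩ ⟨Δ⟩ ⟨Θ⟩
    exact congrArg (Quotient.mk _) (PreSequent.append_assoc Γ Δ Θ)
  zero_add := by
    rintro ⟨Γ⟩
    rfl
  add_zero := by
    rintro ⟨Γ⟩
    exact congrArg (Quotient.mk _) (PreSequent.append_nil Γ)
  add_comm := by
    rintro ⟨Γ⟩ ⟨Δ⟩
    exact Quotient.sound (PreSequent.append_comm_equiv Γ Δ)
  nsmul := nsmulRec

end NSequent

/-! ### Propositional and modal reasoning in the Hilbert system. -/

namespace Formula

theorem neg_neg (A : Formula Atm) : A.neg.neg = A := by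
  induction A <;> simp_all [neg]

theorem boolEval_neg (v : Formula Atm → Prop) (A : Formula Atm) :
    boolEval v A.neg ↔ ¬ boolEval v A := by
  induction A <;> simp_all [neg, boolEval, neg_neg]; tauto

theorem boolEval_imp (v : Formula Atm → Prop) (A B : Formula Atm) :
    boolEval v (A.imp B) ↔ (boolEval v A → boolEval v B) := by
  simp only [imp, boolEval, boolEval_neg]; tauto

end Formula

open Formula

namespace KTheorem

variable {Ax : Set (Formula Atm)} {A B C D : Formula Atm}

/-- Together with the two- and three-premise versions, this replaces propositional derivations by
truth-table checks under `boolEval`. -/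
theorem of_taut₁ (h : KTheorem Ax A) (ht : ∀ v, boolEval v A → boolEval v B) : KTheorem Ax B :=
  .mp (.taut fun v => (boolEval_imp v _ _).2 (ht v)) h

theorem of_taut₂ (h₁ : KTheorem Ax A) (h₂ : KTheorem Ax B)
    (ht : ∀ v, boolEval v A → boolEval v B → boolEval v C) : KTheorem Ax C :=
  .mp (of_taut₁ h₁ fun v h => (boolEval_imp v _ _).2 (ht v h)) h₂

theorem of_taut₃ (h₁ : KTheorem Ax A) (h₂ : KTheorem Ax B) (h₃ : KTheorem Ax C)
    (ht : ∀ v, boolEval v A → boolEval v B → boolEval v C → boolEval v D) : KTheorem Ax D :=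
  .mp (of_taut₂ h₁ h₂ fun v h h' => (boolEval_imp v _ _).2 (ht v h h')) h₃

theorem imp_trans (h₁ : KTheorem Ax (A.imp B)) (h₂ : KTheorem Ax (B.imp C)) :
    KTheorem Ax (A.imp C) :=
  of_taut₂ h₁ h₂ fun v => by simp only [boolEval_imp]; tauto

theorem imp_refl (A : Formula Atm) : KTheorem Ax (A.imp A) :=
  .taut fun v => by simp only [boolEval_imp]; tauto

theorem box_mono (h : KTheorem Ax (A.imp B)) : KTheorem Ax (A.box.imp B.box) :=
  .mp (.k A B) (.nec h)

theorem box_mono₂ (h : KTheorem Ax (A.imp (B.imp C))) :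
    KTheorem Ax (A.box.imp (B.box.imp C.box)) :=
  imp_trans (box_mono h) (.k B C)

/-- `□(A ∨ B) ⊃ (◇A ∨ □B)`. -/
theorem box_or (A B : Formula Atm) :
    KTheorem Ax ((A.or B).box.imp (A.dia.or B.box)) := by
  have h := KTheorem.k (Ax := Ax) A.neg B
  rw [show A.neg.imp B = A.or B by rw [imp, neg_neg]] at h
  refine of_taut₁ h fun v => ?_
  simp only [boolEval_imp, boolEval]; tauto

end KTheorem

/-- Interdeducibility in the Hilbert system. -/
def KEquiv (Ax : Set (Formula Atm)) (A B : Formula Atm) : Prop :=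
  KTheorem Ax (A.imp B) ∧ KTheorem Ax (B.imp A)

namespace KEquiv

variable {Ax : Set (Formula Atm)} {A B C D : Formula Atm}

theorem refl (A : Formula Atm) : KEquiv Ax A A := ⟨.imp_refl A, .imp_refl A⟩

theorem symm (h : KEquiv Ax A B) : KEquiv Ax B A := ⟨h.2, h.1⟩

theorem trans (h₁ : KEquiv Ax A B) (h₂ : KEquiv Ax B C) : KEquiv Ax A C :=
  ⟨h₁.1.imp_trans h₂.1, h₂.2.imp_trans h₁.2⟩

theorem of_taut (h : ∀ v, boolEval v A ↔ boolEval v B) : KEquiv Ax A B :=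
  ⟨.taut fun v => (boolEval_imp v _ _).2 (h v).1, .taut fun v => (boolEval_imp v _ _).2 (h v).2⟩

theorem or (h₁ : KEquiv Ax A B) (h₂ : KEquiv Ax C D) : KEquiv Ax (A.or C) (B.or D) := by
  constructor
  · exact .of_taut₂ h₁.1 h₂.1 fun v => by simp only [boolEval_imp, boolEval]; tauto
  · exact .of_taut₂ h₁.2 h₂.2 fun v => by simp only [boolEval_imp, boolEval]; tauto

theorem box (h : KEquiv Ax A B) : KEquiv Ax A.box B.box := ⟨h.1.box_mono, h.2.box_mono⟩

theorem imp (h₁ : KEquiv Ax A B) (h₂ : KEquiv Ax C D) (h : KTheorem Ax (B.imp D)) :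
    KTheorem Ax (A.imp C) :=
  (h₁.1.imp_trans h).imp_trans h₂.2

end KEquiv

/-! ### The formula reading of nested sequents. -/

/-- The formula reading of an ordered sequent, with the formula `F` in the place of falsity. -/
def PreSequent.toFormula (F : Formula Atm) : PreSequent Atm → Formula Atm
  | nil => F
  | consFormula A Γ => A.or (toFormula F Γ)
  | consBox Δ Γ => (toFormula F Δ).box.or (toFormula F Γ)

theorem PreSequent.Equiv.toFormula {Ax : Set (Formula Atm)} (F : Formula Atm)
    {Γ Δ : PreSequent Atm} (h : Equiv Γ Δ) : KEquiv Ax (Γ.toFormula F) (Δ.toFormula F) := by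
  induction h with
  | refl Γ => exact .refl _
  | symm _ ih => exact ih.symm
  | trans _ _ ih₁ ih₂ => exact ih₁.trans ih₂
  | consFormula A _ ih => exact .or (.refl A) ih
  | consBox _ _ ih₁ ih₂ => exact .or ih₁.box ih₂
  | swapFormulas A B Γ =>
    exact .of_taut fun v => by simp only [PreSequent.toFormula, boolEval]; tauto
  | swapFormulaBox A Δ Γ =>
    exact .of_taut fun v => by simp only [PreSequent.toFormula, boolEval]; tauto
  | swapBoxes Δ Δ' Γ =>
    exact .of_taut fun v => by simp only [PreSequent.toFormula, boolEval]; tauto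

namespace NSequent

/-- The formula reading of a nested sequent, with `p ∧ p̄` for falsity. -/
noncomputable def toFormula (p : Atm) (Γ : NSequent Atm) : Formula Atm :=
  (Quotient.out Γ).toFormula ((atom p).and (natom p))

variable {Ax : Set (Formula Atm)} (p : Atm)

/-- The reading uses an arbitrary representative; up to interdeducibility the choice does not
matter. -/
theorem toFormula_mk (Γ : PreSequent Atm) :
    KEquiv Ax (toFormula p (Quotient.mk _ Γ)) (Γ.toFormula ((atom p).and (natom p))) :=
  PreSequent.Equiv.toFormula _ (Quotient.mk_out (s := PreSequent.setoid Atm) Γ)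

theorem toFormula_ofFormula (A : Formula Atm) : KEquiv Ax (toFormula p (ofFormula A)) A :=
  (toFormula_mk p _).trans <| .of_taut fun v => by
    simp only [PreSequent.toFormula, boolEval]; tauto

theorem toFormula_boxed (Δ : NSequent Atm) :
    KEquiv Ax (toFormula p (boxed Δ)) (toFormula p Δ).box := by
  obtain ⟨Δ⟩ := Δ
  refine (toFormula_mk p (.consBox Δ .nil)).trans <| .trans (.of_taut fun v => ?_)
    (toFormula_mk p Δ).symm.box
  simp only [PreSequent.toFormula, boolEval]; tauto

theorem toFormula_append (F : Formula Atm) (hF : ∀ v, ¬ boolEval v F) (Γ Δ : PreSequent Atm) :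
    KEquiv Ax ((Γ.append Δ).toFormula F) ((Γ.toFormula F).or (Δ.toFormula F)) := by
  refine .of_taut fun v => ?_
  induction Γ with
  | nil => simp [PreSequent.append, PreSequent.toFormula, boolEval, hF v]
  | consFormula A Γ ih => simp only [PreSequent.append, PreSequent.toFormula, boolEval] at *; tauto
  | consBox A Γ _ ih => simp only [PreSequent.append, PreSequent.toFormula, boolEval] at *; tauto

theorem toFormula_add (Γ Δ : NSequent Atm) :
    KEquiv Ax (toFormula p (Γ + Δ)) ((toFormula p Γ).or (toFormula p Δ)) := by
  obtain ⟨Γ⟩ := Γ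
  obtain ⟨Δ⟩ := Δ
  refine (toFormula_mk p (Γ.append Δ)).trans <| .trans (toFormula_append _ ?_ Γ Δ) <|
    .or (toFormula_mk p Γ).symm (toFormula_mk p Δ).symm
  intro v
  simp only [boolEval]; tauto

/-- Each box around ◇A is crossed by `box_or`, at the cost of one more ◇. The extra 1 in the
exponent is the ◇ of ◇A itself, so the exponent is the n of the rule. -/
theorem toFormula_chain (A : Formula Atm) (Δs : List (NSequent Atm)) :
    KTheorem Ax ((toFormula p (chain Δs (ofFormula A.dia))).imp
      ((A.diaPow (Δs.length + 1)).or (toFormula p (chain Δs 0)))) := by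
  induction Δs with
  | nil =>
    refine (toFormula_ofFormula p A.dia).1.of_taut₁ fun v => ?_
    simp only [chain, diaPow, List.length_nil, boolEval_imp, boolEval]; tauto
  | cons Δ Δs ih =>
    have h₁ := (toFormula_boxed (Ax := Ax) p (Δ + chain Δs (ofFormula A.dia))).1
    have h₂ : KTheorem Ax ((toFormula p (Δ + chain Δs (ofFormula A.dia))).imp
        ((A.diaPow (Δs.length + 1)).or (toFormula p (Δ + chain Δs 0)))) := by
      refine .of_taut₃ (toFormula_add p Δ (chain Δs (ofFormula A.dia))).1
        (toFormula_add p Δ (chain Δs 0)).2 ih fun v => ?_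
      simp only [boolEval_imp, boolEval]; tauto
    have h₃ := (h₁.imp_trans h₂.box_mono).imp_trans (.box_or _ _)
    refine h₃.of_taut₂ (toFormula_boxed p (Δ + chain Δs 0)).2 fun v => ?_
    simp only [chain, diaPow, List.length_cons, boolEval_imp, boolEval]; tauto

end NSequent

open NSequent

namespace Context

variable {Ax : Set (Formula Atm)} (p : Atm)

theorem kTheorem_fill (C : Context Atm) {Θ : NSequent Atm} (h : KTheorem Ax (Θ.toFormula p)) :
    KTheorem Ax ((C.fill Θ).toFormula p) := by
  induction C with
  | hole Γ =>
    exact h.of_taut₂ (toFormula_add p Γ Θ).2 fun v => by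
      simp only [fill, boolEval_imp, boolEval]; tauto
  | nest Γ C ih =>
    refine ih.nec.of_taut₃ (toFormula_add p Γ (boxed (C.fill Θ))).2
      (toFormula_boxed p (C.fill Θ)).2 fun v => ?_
    simp only [fill, boolEval_imp, boolEval]; tauto

/-- The hole lies only under ∨ and □, both monotone. Two premises are needed for the ∧ rule; the
one-premise form follows by using the same premise twice. -/
theorem kTheorem_fill_imp₂ (C : Context Atm) {Θ₁ Θ₂ Θ : NSequent Atm}
    (h : KTheorem Ax ((Θ₁.toFormula p).imp ((Θ₂.toFormula p).imp (Θ.toFormula p)))) :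
    KTheorem Ax (((C.fill Θ₁).toFormula p).imp
      (((C.fill Θ₂).toFormula p).imp ((C.fill Θ).toFormula p))) := by
  have add_imp₂ : ∀ {Γ Λ₁ Λ₂ Λ : NSequent Atm},
      KTheorem Ax ((Λ₁.toFormula p).imp ((Λ₂.toFormula p).imp (Λ.toFormula p))) →
      KTheorem Ax (((Γ + Λ₁).toFormula p).imp
        (((Γ + Λ₂).toFormula p).imp ((Γ + Λ).toFormula p))) := by
    intro Γ Λ₁ Λ₂ Λ h
    refine .mp (h.of_taut₃ (toFormula_add p Γ Λ₁).1 (toFormula_add p Γ Λ₂).1 fun v => ?_)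
      (toFormula_add p Γ Λ).2
    simp only [boolEval_imp, boolEval]; tauto
  induction C with
  | hole Γ => exact add_imp₂ h
  | nest Γ C ih =>
    refine add_imp₂ (.mp (ih.box_mono₂.of_taut₃ (toFormula_boxed p (C.fill Θ₁)).1
      (toFormula_boxed p (C.fill Θ₂)).1 fun v => ?_) (toFormula_boxed p (C.fill Θ)).2)
    simp only [boolEval_imp]; tauto

theorem kTheorem_fill_imp (C : Context Atm) {Θ₁ Θ : NSequent Atm}
    (h : KTheorem Ax ((Θ₁.toFormula p).imp (Θ.toFormula p)))
    (hC : KTheorem Ax ((C.fill Θ₁).toFormula p)) : KTheorem Ax ((C.fill Θ).toFormula p) := by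
  have h' : KTheorem Ax ((Θ₁.toFormula p).imp ((Θ₁.toFormula p).imp (Θ.toFormula p))) :=
    h.of_taut₁ fun v => by simp only [boolEval_imp]; tauto
  exact .mp (.mp (kTheorem_fill_imp₂ p C h') hC) hC

end Context

/-! ### The nested rules preserve Hilbert provability. -/

theorem NKRule.kTheorem_toFormula {Ax : Set (Formula Atm)} (p : Atm) {Ps : List (NSequent Atm)}
    {Γ : NSequent Atm} (h : NKRule Ps Γ) (hP : ∀ P ∈ Ps, KTheorem Ax (P.toFormula p)) :
    KTheorem Ax (Γ.toFormula p) := by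
  cases h with
  | id C q =>
    refine C.kTheorem_fill p (.mp (toFormula_add p _ _).2 ?_)
    refine (toFormula_ofFormula p (atom q)).2.of_taut₂
      (toFormula_ofFormula p (natom q)).2 fun v => ?_
    simp only [boolEval_imp, boolEval]; tauto
  | or C A B =>
    refine C.kTheorem_fill_imp p ?_ (hP _ (List.mem_singleton_self _))
    exact ((toFormula_add p _ _).trans
      ((toFormula_ofFormula p A).or (toFormula_ofFormula p B))).1.imp_trans
      (toFormula_ofFormula p (A.or B)).2
  | and C A B =>
    refine .mp (.mp (C.kTheorem_fill_imp₂ p ?_) (hP (C.fill (ofFormula A)) (by simp)))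
      (hP (C.fill (ofFormula B)) (by simp))
    refine (toFormula_ofFormula p A).1.of_taut₃ (toFormula_ofFormula p B).1
      (toFormula_ofFormula p (A.and B)).2 fun v => ?_
    simp only [boolEval_imp, boolEval]; tauto
  | box C A =>
    refine C.kTheorem_fill_imp p ?_ (hP _ (List.mem_singleton_self _))
    exact ((toFormula_boxed p _).trans (toFormula_ofFormula p A).box).1.imp_trans
      (toFormula_ofFormula p A.box).2
  | dia C A Δ =>
    refine C.kTheorem_fill_imp p ?_ (hP _ (List.mem_singleton_self _))
    refine KEquiv.imp ((toFormula_add p _ _).trans ((toFormula_ofFormula p A.dia).or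
      ((toFormula_boxed p _).trans ((toFormula_add p _ _).trans
        ((toFormula_ofFormula p A).or (.refl _))).box)))
      ((toFormula_add p _ _).trans ((toFormula_ofFormula p A.dia).or (toFormula_boxed p Δ))) ?_
    -- The premise reads ◇A ∨ □(A ∨ Δ); `box_or` turns the second disjunct into ◇A ∨ □Δ.
    refine (KTheorem.box_or A (Δ.toFormula p)).of_taut₁ fun v => ?_
    simp only [boolEval_imp, boolEval]; tauto

theorem dia4_kTheorem_toFormula {X : Set ℕ} (p : Atm) {n : ℕ} (hn : n ∈ X)
    {Ps : List (NSequent Atm)} {Γ : NSequent Atm} (h : (Ps, Γ) ∈ dia4 Atm n)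
    (hP : ∀ P ∈ Ps, KTheorem (quasiTransAxioms Atm X) (P.toFormula p)) :
    KTheorem (quasiTransAxioms Atm X) (Γ.toFormula p) := by
  obtain ⟨C, A, Δs, hl, h⟩ := h
  obtain ⟨rfl, rfl⟩ := Prod.mk.inj h
  refine C.kTheorem_fill_imp p ?_ (hP _ (List.mem_singleton_self _))
  refine KEquiv.imp ((toFormula_add p _ _).trans ((toFormula_ofFormula p A.dia).or (.refl _)))
    ((toFormula_add p _ _).trans ((toFormula_ofFormula p A.dia).or (.refl _))) ?_
  have hax : KTheorem (quasiTransAxioms Atm X) ((A.diaPow (Δs.length + 1)).imp A.dia) :=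
    .ax ⟨n, hn, A, by rw [hl]⟩
  refine hax.of_taut₂ (toFormula_chain p A Δs) fun v => ?_
  simp only [boolEval_imp, boolEval]; tauto

/-- Every theorem of the nested sequent system is a theorem of the Hilbert system. -/
theorem Provable.kTheorem_toFormula {X : Set ℕ} (p : Atm) {Γ : NSequent Atm}
    (h : Provable (nK Atm ∪ dia4Set Atm X) Γ) :
    KTheorem (quasiTransAxioms Atm X) (Γ.toFormula p) := by
  induction h with
  | infer hr _ ih =>
    rcases hr with hr | hr
    · exact NKRule.kTheorem_toFormula p hr ih
    · simp only [dia4Set, Set.mem_iUnion] at hr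
      obtain ⟨n, hn, hr⟩ := hr
      exact dia4_kTheorem_toFormula p hn hr ih

/-- A variable that occurs in the formula. -/
def Formula.someAtom : Formula Atm → Atm
  | atom p => p
  | natom p => p
  | and A _ => someAtom A
  | or A _ => someAtom A
  | box A => someAtom A
  | dia A => someAtom A

/-- Falsity is expressed as p ∧ p̄, so some variable p is needed; A itself supplies one. -/
theorem Provable.kTheorem {X : Set ℕ} {A : Formula Atm}
    (h : Provable (nK Atm ∪ dia4Set Atm X) (ofFormula A)) :
    KTheorem (quasiTransAxioms Atm X) A :=
  .mp (toFormula_ofFormula A.someAtom A).1 (h.kTheorem_toFormula A.someAtom)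

/-! ### Kripke semantics of the Hilbert system. -/

/-- Truth at a world of the Kripke model with accessibility relation `R` and valuation `V`. -/
def Formula.Forces {W : Type*} (R : W → W → Prop) (V : Atm → W → Prop) : W → Formula Atm → Prop
  | w, atom p => V p w
  | w, natom p => ¬ V p w
  | w, and A B => Forces R V w A ∧ Forces R V w B
  | w, or A B => Forces R V w A ∨ Forces R V w B
  | w, box A => ∀ u, R w u → Forces R V u A
  | w, dia A => ∃ u, R w u ∧ Forces R V u A

/-- `RelPow R n w u`: there is an `R`-path of length `n` from `w` to `u`. -/
def RelPow {W : Type*} (R : W → W → Prop) : ℕ → W → W → Prop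
  | 0, w, u => w = u
  | n + 1, w, u => ∃ x, R w x ∧ RelPow R n x u

section Forces

variable {W : Type*} (R : W → W → Prop) (V : Atm → W → Prop)

theorem forces_neg (w : W) (A : Formula Atm) : Forces R V w A.neg ↔ ¬ Forces R V w A := by
  induction A generalizing w <;> simp_all [Forces, neg]; tauto

theorem forces_imp (w : W) (A B : Formula Atm) :
    Forces R V w (A.imp B) ↔ (Forces R V w A → Forces R V w B) := by
  simp only [Formula.imp, Forces, forces_neg]; tauto

theorem boolEval_forces (w : W) (A : Formula Atm) :
    boolEval (Forces R V w) A ↔ Forces R V w A := by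
  induction A <;> simp_all [Forces, boolEval, forces_neg]

theorem forces_diaPow (n : ℕ) (w : W) (A : Formula Atm) :
    Forces R V w (A.diaPow n) ↔ ∃ u, RelPow R n w u ∧ Forces R V u A := by
  induction n generalizing w with
  | zero => simp [diaPow, RelPow]
  | succ n ih =>
    simp only [diaPow, Forces, RelPow, ih]
    constructor
    · rintro ⟨u, hu, x, hx, h⟩; exact ⟨x, ⟨u, hu, hx⟩, h⟩
    · rintro ⟨x, ⟨u, hu, hx⟩, h⟩; exact ⟨u, hu, x, hx, h⟩

/-- Theorems of the Hilbert system hold in all frames with `Rⁿ ⊆ R` for `n ∈ X`. -/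
theorem KTheorem.forces {X : Set ℕ} (hR : ∀ n ∈ X, ∀ w u, RelPow R n w u → R w u)
    {A : Formula Atm} (h : KTheorem (quasiTransAxioms Atm X) A) (w : W) : Forces R V w A := by
  induction h generalizing w with
  | taut h => exact (boolEval_forces R V w _).1 (h _)
  | k A B =>
    simp only [forces_imp]
    intro h₁ h₂ u hu
    exact (forces_imp R V u A B).1 (h₁ u hu) (h₂ u hu)
  | ax h =>
    obtain ⟨n, hn, A, rfl⟩ := h
    rw [forces_imp, forces_diaPow]
    rintro ⟨u, hu, h⟩
    exact ⟨u, hR n hn w u hu, h⟩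
  | mp _ _ ih₁ ih₂ => exact (forces_imp R V w _ _).1 (ih₁ w) (ih₂ w)
  | nec _ ih => exact fun u _ => ih u

end Forces

/-! ### Countability of the demands and generic ideals. -/

instance Formula.countable [Countable Atm] : Countable (Formula Atm) := by
  let S : ℕ → Set (Formula Atm) := fun n => Nat.rec ∅ (fun _ T =>
    Set.range atom ∪ Set.range natom ∪ Set.image2 and T T ∪ Set.image2 or T T ∪
      box '' T ∪ dia '' T ∪ T) n
  have hS : ∀ n, (S n).Countable := by
    intro n
    induction n with
    | zero => exact Set.countable_empty
    | succ n ih =>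
      exact ((((((Set.countable_range _).union (Set.countable_range _)).union
        (ih.image2 ih _)).union (ih.image2 ih _)).union (ih.image _)).union (ih.image _)).union ih
  have hmono : Monotone S := monotone_nat_of_le_succ fun n => Set.subset_union_right
  have hmem : ∀ A : Formula Atm, ∃ n, A ∈ S n := by
    have aux : ∀ n (T : Set (Formula Atm)), S n = T → S (n + 1) =
      Set.range atom ∪ Set.range natom ∪ Set.image2 and T T ∪ Set.image2 or T T ∪
        box '' T ∪ dia '' T ∪ T := by rintro n _ rfl; rfl
    intro A
    induction A with
    | atom p => exact ⟨0 + 1, by rw [aux 0 _ rfl]; simp⟩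
    | natom p => exact ⟨0 + 1, by rw [aux 0 _ rfl]; simp⟩
    | and A B hA hB =>
      obtain ⟨m, hm⟩ := hA
      obtain ⟨n, hn⟩ := hB
      refine ⟨max m n + 1, ?_⟩
      have := Set.mem_image2_of_mem (f := and) (hmono (le_max_left m n) hm)
        (hmono (le_max_right m n) hn)
      rw [aux _ _ rfl]; simp only [Set.mem_union]; tauto
    | or A B hA hB =>
      obtain ⟨m, hm⟩ := hA
      obtain ⟨n, hn⟩ := hB
      refine ⟨max m n + 1, ?_⟩
      have := Set.mem_image2_of_mem (f := or) (hmono (le_max_left m n) hm)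
        (hmono (le_max_right m n) hn)
      rw [aux _ _ rfl]; simp only [Set.mem_union]; tauto
    | box A hA =>
      obtain ⟨m, hm⟩ := hA
      refine ⟨m + 1, ?_⟩
      have := Set.mem_image_of_mem box hm
      rw [aux _ _ rfl]; simp only [Set.mem_union]; tauto
    | dia A hA =>
      obtain ⟨m, hm⟩ := hA
      refine ⟨m + 1, ?_⟩
      have := Set.mem_image_of_mem dia hm
      rw [aux _ _ rfl]; simp only [Set.mem_union]; tauto
  refine Set.countable_univ_iff.1 ((Set.countable_iUnion hS).mono fun A _ => ?_)
  exact Set.mem_iUnion.2 (hmem A)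

/-- If each condition `a i` is upward closed and can always be answered by `b i` further up, then
some directed set answers every condition that it meets. -/
theorem exists_ideal_answering {P ι : Type*} [Preorder P] [Countable ι] (a b : ι → P → Prop)
    (ha : ∀ i s s', s ≤ s' → a i s → a i s') (hab : ∀ i s, a i s → ∃ s', s ≤ s' ∧ b i s') (p : P) :
    ∃ I : Order.Ideal P, p ∈ I ∧ ∀ i, ∀ s ∈ I, a i s → ∃ s' ∈ I, b i s' := by
  have := Encodable.ofCountable ι
  -- Cofinal because a condition either has an extension satisfying `a i`, which can then be
  -- answered, or already rules `a i` out for good.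
  let D : ι → Order.Cofinal P := fun i =>
    { carrier := {s | b i s ∨ ∀ s', s ≤ s' → ¬ a i s'}
      isCofinal := by
        intro s
        by_cases h : ∃ s', s ≤ s' ∧ a i s'
        · obtain ⟨s', hs, h⟩ := h
          obtain ⟨s'', hs', h'⟩ := hab i s' h
          exact ⟨s'', Or.inl h', hs.trans hs'⟩
        · push Not at h
          exact ⟨s, Or.inr h, le_rfl⟩ }
  refine ⟨Order.idealOfCofinals p D, Order.mem_idealOfCofinals p D, fun i s hs h => ?_⟩
  obtain ⟨s', hs', hI⟩ := Order.cofinal_meets_idealOfCofinals p D i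
  rcases hs' with hb | hn
  · exact ⟨s', hI, hb⟩
  -- A common upper bound in the ideal would satisfy `a i`, which s' excludes.
  · obtain ⟨s'', _, h₁, h₂⟩ := (Order.idealOfCofinals p D).directed s hs s' hI
    exact absurd (ha i s s'' h₁ h) (hn s'' h₂)

/-! ### Sequents as trees with stable addresses. -/

/-- Finite trees of multisets of formulas; `nil` is the tree without
formulas and children, and only the children `ch i` with `i < k` count. -/
inductive SequentTree (Atm : Type*) where
  | nil : SequentTree Atm
  | node (M : Multiset (Formula Atm)) (k : ℕ) (ch : ℕ → SequentTree Atm) : SequentTree Atm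

/-- The nested sequent that consists of the formulas of a multiset. -/
def NSequent.ofMultiset (M : Multiset (Formula Atm)) : NSequent Atm := (M.map ofFormula).sum

theorem NSequent.ofMultiset_cons (A : Formula Atm) (M : Multiset (Formula Atm)) :
    ofMultiset (A ::ₘ M) = ofMultiset M + ofFormula A := by
  simp [ofMultiset, add_comm]

theorem NSequent.ofMultiset_singleton (A : Formula Atm) :
    ofMultiset {A} = ofFormula A := by
  simp [ofMultiset]

/-- Adding the sequent `Γ` next to the hole. -/
def Context.addHole (Γ : NSequent Atm) : Context Atm → Context Atm
  | .hole Δ => .hole (Δ + Γ)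
  | .nest Δ C => .nest Δ (C.addHole Γ)

theorem Context.addHole_fill (Γ Θ : NSequent Atm) (C : Context Atm) :
    (C.addHole Γ).fill Θ = C.fill (Γ + Θ) := by
  induction C with
  | hole Δ => simp [addHole, fill, add_assoc]
  | nest Δ C ih => simp [addHole, fill, ih]

namespace SequentTree

/-- The nested sequent of a tree. -/
def toSequent : SequentTree Atm → NSequent Atm
  | nil => 0
  | node M k ch => ofMultiset M + ∑ i ∈ Finset.range k, boxed (toSequent (ch i))

/-- The formulas at the root. -/
def root : SequentTree Atm → Multiset (Formula Atm)
  | nil => 0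
  | node M _ _ => M

/-- The number of children of the root. -/
def width : SequentTree Atm → ℕ
  | nil => 0
  | node _ k _ => k

/-- The children of the root. -/
def child : SequentTree Atm → ℕ → SequentTree Atm
  | nil => fun _ => nil
  | node _ _ ch => ch

/-- The position `w` exists in the tree. -/
def Dom : List ℕ → SequentTree Atm → Prop
  | [], _ => True
  | i :: w, t => i < t.width ∧ Dom w (t.child i)

/-- The subtree at the position `w`. -/
def get : List ℕ → SequentTree Atm → SequentTree Atm
  | [], t => t
  | i :: w, t => get w (t.child i)

/-- Applying `f` to the subtree at the position `w`. -/
def modify (f : SequentTree Atm → SequentTree Atm) : List ℕ → SequentTree Atm → SequentTree Atm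
  | [], t => f t
  | i :: w, t => node t.root t.width (Function.update t.child i (modify f w (t.child i)))

/-- The formula `A` stands at the position `w`. -/
def Has (t : SequentTree Atm) (w : List ℕ) (A : Formula Atm) : Prop := Dom w t ∧ A ∈ (get w t).root

theorem dom_append (w v : List ℕ) (t : SequentTree Atm) :
    Dom (w ++ v) t ↔ Dom w t ∧ Dom v (get w t) := by
  induction w generalizing t with
  | nil => simp [Dom, get]
  | cons i w ih => simp [Dom, get, ih, and_assoc]

theorem get_append (w v : List ℕ) (t : SequentTree Atm) : get (w ++ v) t = get v (get w t) := by
  induction w generalizing t with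
  | nil => rfl
  | cons i w ih => exact ih _

theorem modify_append (f : SequentTree Atm → SequentTree Atm) (w v : List ℕ) (t : SequentTree Atm) :
    modify f (w ++ v) t = modify (modify f v) w t := by
  induction w generalizing t with
  | nil => rfl
  | cons i w ih => simp [modify, ih]

theorem dom_modify_self (f : SequentTree Atm → SequentTree Atm) {w : List ℕ} {t : SequentTree Atm} (h : Dom w t) :
    Dom w (modify f w t) := by
  induction w generalizing t with
  | nil => trivial
  | cons i w ih => exact ⟨h.1, by simpa [modify, child] using ih h.2⟩

theorem get_modify_self (f : SequentTree Atm → SequentTree Atm) (w : List ℕ) (t : SequentTree Atm) :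
    get w (modify f w t) = f (get w t) := by
  induction w generalizing t with
  | nil => rfl
  | cons i w ih => simpa [modify, child, get] using ih (t.child i)

theorem toSequent_eq (t : SequentTree Atm) :
    t.toSequent = ofMultiset t.root + ∑ i ∈ Finset.range t.width, boxed (t.child i).toSequent := by
  cases t with
  | nil => simp [toSequent, root, width, ofMultiset]
  | node M k ch => rfl

theorem toSequent_eq_of_lt (t : SequentTree Atm) {i : ℕ} (hi : i < t.width) :
    t.toSequent = ofMultiset t.root + ∑ j ∈ (Finset.range t.width).erase i,
      boxed (t.child j).toSequent + boxed (t.child i).toSequent := by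
  rw [toSequent_eq, add_assoc, Finset.sum_erase_add _ _ (Finset.mem_range.2 hi)]

theorem toSequent_update (t : SequentTree Atm) {i : ℕ} (hi : i < t.width) (u : SequentTree Atm) :
    (node t.root t.width (Function.update t.child i u)).toSequent =
      ofMultiset t.root + ∑ j ∈ (Finset.range t.width).erase i,
        boxed (t.child j).toSequent + boxed u.toSequent := by
  rw [toSequent_eq_of_lt (node t.root t.width (Function.update t.child i u)) (i := i) hi]
  simp only [root, width, child, Function.update_self]
  congr 2
  refine Finset.sum_congr rfl fun j hj => ?_
  rw [Function.update_of_ne (Finset.ne_of_mem_erase hj)]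

/-- One context serves the tree and all its modifications at w, so premise and conclusion of a rule
can be compared. -/
theorem exists_context {w : List ℕ} {t : SequentTree Atm} (h : Dom w t) :
    ∃ C : Context Atm, t.toSequent = C.fill (get w t).toSequent ∧
      ∀ f, (modify f w t).toSequent = C.fill (f (get w t)).toSequent := by
  induction w generalizing t with
  | nil => exact ⟨.hole 0, by simp [Context.fill, get], by simp [Context.fill, get, modify]⟩
  | cons i w ih =>
    obtain ⟨C, h₁, h₂⟩ := ih h.2
    refine ⟨.nest (ofMultiset t.root + ∑ j ∈ (Finset.range t.width).erase i,
        boxed (t.child j).toSequent) C, ?_, fun f => ?_⟩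
    · rw [toSequent_eq_of_lt t h.1, h₁]; rfl
    · rw [modify, toSequent_update t h.1, h₂]; rfl

/-- Adding a formula at the root. -/
def addRoot (A : Formula Atm) (t : SequentTree Atm) : SequentTree Atm := node (A ::ₘ t.root) t.width t.child

theorem toSequent_addRoot (A : Formula Atm) (t : SequentTree Atm) :
    (addRoot A t).toSequent = t.toSequent + ofFormula A := by
  rw [toSequent_eq, toSequent_eq t]
  simp only [addRoot, root, width, child, ofMultiset_cons]
  abel

/-- Walking along v, the material off the path at each level is collected into Γ or an entry of the
chain. The last clause keeps the root formulas visible in Γ, as the ◇ rules need their principal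
formula there. -/
theorem exists_chain {v : List ℕ} {t : SequentTree Atm} (h : Dom v t) :
    ∃ (Γ : NSequent Atm) (Δs : List (NSequent Atm)), Δs.length = v.length ∧
      t.toSequent = Γ + chain Δs 0 ∧
      (∀ A, (modify (addRoot A) v t).toSequent = Γ + chain Δs (ofFormula A)) ∧
      (v ≠ [] → ∃ Θ, Γ = ofMultiset t.root + Θ) := by
  induction v generalizing t with
  | nil =>
    exact ⟨t.toSequent, [], rfl, by simp [chain], fun A => toSequent_addRoot A t, by simp⟩
  | cons i v ih =>
    obtain ⟨Γ, Δs, hl, h₁, h₂, -⟩ := ih h.2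
    refine ⟨ofMultiset t.root + ∑ j ∈ (Finset.range t.width).erase i,
        boxed (t.child j).toSequent, Γ :: Δs, by simp [hl], ?_, fun A => ?_, fun _ => ⟨_, rfl⟩⟩
    · rw [toSequent_eq_of_lt t h.1, h₁]; rfl
    · rw [modify, toSequent_update t h.1, h₂]; rfl

/-- Everything in `t` is also in `t'`, except perhaps for the formula `F` at the position `w`. -/
def Extends (F : Formula Atm) (w : List ℕ) (t t' : SequentTree Atm) : Prop :=
  (∀ v, Dom v t → Dom v t') ∧ ∀ v A, t.Has v A → t'.Has v A ∨ v = w ∧ A = F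

theorem Extends.modify {F : Formula Atm} {f : SequentTree Atm → SequentTree Atm} {w : List ℕ} {t : SequentTree Atm}
    (h : Extends F [] (get w t) (f (get w t))) : Extends F w t (modify f w t) := by
  induction w generalizing t with
  | nil => exact h
  | cons i w ih =>
    obtain ⟨h₁, h₂⟩ := ih (t := t.child i) h
    constructor
    · rintro (_ | ⟨j, v⟩) hv
      · trivial
      · refine ⟨hv.1, ?_⟩
        rcases eq_or_ne j i with rfl | hj
        · simpa [SequentTree.modify, child] using h₁ v hv.2
        · simpa [SequentTree.modify, child, hj] using hv.2
    · rintro (_ | ⟨j, v⟩) A hv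
      · exact Or.inl hv
      · rcases eq_or_ne j i with rfl | hj
        · rcases h₂ v A ⟨hv.1.2, hv.2⟩ with h' | ⟨rfl, rfl⟩
          · exact Or.inl ⟨⟨hv.1.1, by simpa [SequentTree.modify, child] using h'.1⟩,
              by simpa [SequentTree.modify, child, get] using h'.2⟩
          · exact Or.inr ⟨rfl, rfl⟩
        · exact Or.inl ⟨⟨hv.1.1, by simpa [SequentTree.modify, child, hj] using hv.1.2⟩,
            by simpa [SequentTree.modify, child, get, hj] using hv.2⟩

theorem extends_root {F : Formula Atm} {t t' : SequentTree Atm} (hw : t.width ≤ t'.width)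
    (hc : ∀ i < t.width, t'.child i = t.child i)
    (hM : ∀ A ∈ t.root, A ∈ t'.root ∨ A = F) : Extends F [] t t' := by
  constructor
  · rintro (_ | ⟨j, v⟩) hv
    · trivial
    · exact ⟨hv.1.trans_le hw, by rw [hc j hv.1]; exact hv.2⟩
  · rintro (_ | ⟨j, v⟩) A hv
    · exact (hM A hv.2).imp (fun h => ⟨trivial, h⟩) fun h => ⟨rfl, h⟩
    · refine Or.inl ⟨⟨hv.1.1.trans_le hw, by rw [hc j hv.1.1]; exact hv.1.2⟩, ?_⟩
      simpa [get, hc j hv.1.1] using hv.2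

/-- The formula stands at the position, or has been decomposed there. -/
def Sat (t : SequentTree Atm) : List ℕ → Formula Atm → Prop
  | w, atom p => t.Has w (atom p)
  | w, natom p => t.Has w (natom p)
  | w, .and A B => t.Has w (.and A B) ∨ (Sat t w A ∨ Sat t w B)
  | w, .or A B => t.Has w (.or A B) ∨ (Sat t w A ∧ Sat t w B)
  | w, box A => t.Has w (box A) ∨ ∃ i, Dom (w ++ [i]) t ∧ Sat t (w ++ [i]) A
  | w, dia A => t.Has w (dia A)

theorem Has.sat {t : SequentTree Atm} {w : List ℕ} {A : Formula Atm} (h : t.Has w A) : t.Sat w A := by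
  cases A <;> simp only [Sat] <;> tauto

/-- The only formula that may be lost is F at w, and there t' still satisfies it through its
components. -/
theorem Extends.sat_mono {F : Formula Atm} {w : List ℕ} {t t' : SequentTree Atm} (h : Extends F w t t')
    (hF : t'.Sat w F) {v : List ℕ} {A : Formula Atm} (hA : t.Sat v A) : t'.Sat v A := by
  have key : ∀ v A, t.Has v A → t'.Sat v A := by
    intro v A hA
    rcases h.2 v A hA with h' | ⟨rfl, rfl⟩
    exacts [h'.sat, hF]
  induction A generalizing v with
  | atom p => exact key _ _ hA
  | natom p => exact key _ _ hA
  | dia A => exact key _ _ hA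
  | and A B ihA ihB =>
    rcases hA with hA | hA
    · exact key _ _ hA
    · exact Or.inr (hA.imp ihA ihB)
  | or A B ihA ihB =>
    rcases hA with hA | hA
    · exact key _ _ hA
    · exact Or.inr (hA.imp ihA ihB)
  | box A ih =>
    rcases hA with hA | ⟨i, hi, hA⟩
    · exact key _ _ hA
    · exact Or.inr ⟨i, h.1 _ hi, ih hA⟩

/-- The rules for ∧, ∨ and □ consume their principal formula, so `Has` need not grow from conclusion
to premise; `Sat` does. -/
instance : Preorder (SequentTree Atm) where
  le t t' := (∀ v, Dom v t → Dom v t') ∧ ∀ v A, t.Sat v A → t'.Sat v A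
  le_refl t := ⟨fun _ h => h, fun _ _ h => h⟩
  le_trans _ _ _ h₁ h₂ := ⟨fun v h => h₂.1 v (h₁.1 v h), fun v A h => h₂.2 v A (h₁.2 v A h)⟩

theorem Extends.le {F : Formula Atm} {w : List ℕ} {t t' : SequentTree Atm} (h : Extends F w t t')
    (hF : t'.Sat w F) : t ≤ t' :=
  ⟨h.1, fun _ _ hA => h.sat_mono hF hA⟩

end SequentTree

/-! ### Extending unprovable trees by reading rules upwards. -/

namespace SequentTree

/-- This produces premises of the ∧, ∨ and □ rules: F is overwritten by its components or by a new
child, always in the same context C. -/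
theorem Has.exists_replace {t : SequentTree Atm} {w : List ℕ} {F : Formula Atm} (h : t.Has w F) :
    ∃ C : Context Atm, t.toSequent = C.fill (ofFormula F) ∧
      (∀ N : Multiset (Formula Atm), ∃ t', t'.toSequent = C.fill (ofMultiset N) ∧
        Extends F w t t' ∧ ∀ A ∈ N, t'.Has w A) ∧
      ∀ A : Formula Atm, ∃ t', t'.toSequent = C.fill (boxed (ofFormula A)) ∧
        Extends F w t t' ∧ ∃ i, t'.Has (w ++ [i]) A := by
  obtain ⟨hd, hF⟩ := h
  obtain ⟨M, hM⟩ := Multiset.exists_cons_of_mem hF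
  obtain ⟨C, h₁, h₂⟩ := exists_context hd
  set u := get w t with hu
  refine ⟨C.addHole (ofMultiset M + ∑ i ∈ Finset.range u.width, boxed (u.child i).toSequent),
    ?_, fun N => ⟨modify (fun u => node (N + M) u.width u.child) w t, ?_, ?_, ?_⟩,
    -- The new child takes the first free index, so all existing positions keep their addresses.
    fun A => ⟨modify (fun u => node M (u.width + 1)
      (Function.update u.child u.width (node {A} 0 fun _ => nil))) w t, ?_, ?_, u.width, ?_⟩⟩
  · rw [Context.addHole_fill, h₁, toSequent_eq u, hM, ofMultiset_cons, add_right_comm]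
  · rw [Context.addHole_fill, h₂, toSequent]
    congr 1
    rw [ofMultiset, Multiset.map_add, Multiset.sum_add]
    change ofMultiset N + ofMultiset M + _ = _
    abel
  · refine Extends.modify (extends_root le_rfl (fun _ _ => rfl) fun A hA => ?_)
    rw [← hu, hM, Multiset.mem_cons] at hA
    exact hA.symm.imp_left fun h => Multiset.mem_add.2 (Or.inr h)
  · intro A hA
    refine ⟨dom_modify_self _ hd, ?_⟩
    rw [get_modify_self]
    exact Multiset.mem_add.2 (Or.inl hA)
  · rw [Context.addHole_fill, h₂, toSequent, Finset.sum_range_succ, Function.update_self,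
      ← add_assoc, toSequent, Finset.range_zero, Finset.sum_empty, add_zero, ofMultiset_singleton]
    congr 3
    refine Finset.sum_congr rfl fun j hj => ?_
    rw [Function.update_of_ne (Finset.mem_range.1 hj).ne]
  · refine Extends.modify (extends_root (Nat.le_succ _) (fun i hi => ?_) fun A hA => ?_)
    · exact Function.update_of_ne hi.ne _ _
    · rw [← hu, hM, Multiset.mem_cons] at hA
      exact hA.symm
  · constructor
    · rw [dom_append, get_modify_self]
      exact ⟨dom_modify_self _ hd, Nat.lt_succ_self _, trivial⟩
    · rw [get_append, get_modify_self]
      simp [get, child, root, ← hu]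

theorem Has.exists_decomposition₂ {t : SequentTree Atm} {w : List ℕ} {F G : Formula Atm} (hFG : F ≠ G)
    (hF : t.Has w F) (hG : t.Has w G) :
    ∃ C : Context Atm, t.toSequent = C.fill (ofFormula F + ofFormula G) := by
  obtain ⟨M, hM⟩ := Multiset.exists_cons_of_mem hF.2
  have hG' : G ∈ M := by
    have := hG.2
    rw [hM, Multiset.mem_cons] at this
    exact this.resolve_left hFG.symm
  obtain ⟨N, rfl⟩ := Multiset.exists_cons_of_mem hG'
  obtain ⟨C, h, -⟩ := exists_context hF.1
  refine ⟨C.addHole (ofMultiset N + ∑ i ∈ Finset.range (get w t).width,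
    boxed ((get w t).child i).toSequent), ?_⟩
  rw [h, Context.addHole_fill, toSequent_eq, hM, ofMultiset_cons, ofMultiset_cons]
  congr 1
  abel

/-- The sequent of the tree has no cut-free proof. -/
def Unprovable (X : Set ℕ) (t : SequentTree Atm) : Prop :=
  ¬ Provable (nK Atm ∪ dia4Set Atm X) t.toSequent

/-- The components of `F` that its decomposition at `w` asks for are there. -/
def Decomposed (t : SequentTree Atm) (w : List ℕ) : Formula Atm → Prop
  | .and A B => t.Sat w A ∨ t.Sat w B
  | .or A B => t.Sat w A ∧ t.Sat w B
  | .box A => ∃ i, Dom (w ++ [i]) t ∧ t.Sat (w ++ [i]) A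
  | _ => True

/-- An unprovable conclusion has an unprovable premise, and that premise is the required extension.
If F was decomposed before, the tree itself will do. -/
theorem Unprovable.exists_decomposed {X : Set ℕ} {t : SequentTree Atm} (ht : t.Unprovable X)
    {w : List ℕ} {F : Formula Atm} (hF : t.Sat w F) :
    ∃ t', t ≤ t' ∧ t'.Unprovable X ∧ t'.Decomposed w F := by
  cases F with
  | atom p => exact ⟨t, le_rfl, ht, trivial⟩
  | natom p => exact ⟨t, le_rfl, ht, trivial⟩
  | dia A => exact ⟨t, le_rfl, ht, trivial⟩
  | and A B =>
    rcases hF with hF | hF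
    · obtain ⟨C, hC, hN, -⟩ := hF.exists_replace
      obtain ⟨tA, hA, hA', hA''⟩ := hN {A}
      obtain ⟨tB, hB, hB', hB''⟩ := hN {B}
      rw [ofMultiset_singleton] at hA hB
      have hsA := (hA'' A (by simp)).sat
      have hsB := (hB'' B (by simp)).sat
      -- If the left premise is provable, the right one cannot be.
      by_cases h : tA.Unprovable X
      · exact ⟨tA, hA'.le (Or.inr (Or.inl hsA)), h, Or.inl hsA⟩
      · refine ⟨tB, hB'.le (Or.inr (Or.inr hsB)), fun h' => ht ?_, Or.inr hsB⟩
        rw [Unprovable, not_not, hA] at h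
        rw [hB] at h'
        rw [hC]
        refine .infer (Or.inl (NKRule.and C A B)) ?_
        simp [h, h']
    · exact ⟨t, le_rfl, ht, hF⟩
  | or A B =>
    rcases hF with hF | hF
    · obtain ⟨C, hC, hN, -⟩ := hF.exists_replace
      obtain ⟨t', h, h', h''⟩ := hN {A, B}
      have hs : t'.Sat w A ∧ t'.Sat w B := ⟨(h'' A (by simp)).sat, (h'' B (by simp)).sat⟩
      refine ⟨t', h'.le (Or.inr hs), fun hp => ht ?_, hs⟩
      rw [hC]
      refine .infer (Or.inl (NKRule.or C A B)) ?_
      rw [h, Multiset.insert_eq_cons, ofMultiset_cons, ofMultiset_singleton, add_comm] at hp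
      simpa using hp
    · exact ⟨t, le_rfl, ht, hF⟩
  | box A =>
    rcases hF with hF | hF
    · obtain ⟨C, hC, -, hb⟩ := hF.exists_replace
      obtain ⟨t', h, h', i, hi⟩ := hb A
      have hs : ∃ i, Dom (w ++ [i]) t' ∧ t'.Sat (w ++ [i]) A := ⟨i, hi.1, hi.sat⟩
      refine ⟨t', h'.le (Or.inr hs), fun hp => ht ?_, hs⟩
      rw [hC]
      refine .infer (Or.inl (NKRule.box C A)) ?_
      rw [h] at hp
      simpa using hp
    · exact ⟨t, le_rfl, ht, hF⟩

/-- A formula `◇A` at a position makes `F` appear at the positions `m` levels below. -/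
def Propagates (X : Set ℕ) (A : Formula Atm) (m : ℕ) (F : Formula Atm) : Prop :=
  F = A ∧ m = 1 ∨ F = A.dia ∧ m + 1 ∈ X

/-- The ◇ rule and ◇₄ₙ keep ◇A and only add a formula below it, so the premise is the old tree with
F added at w ++ v. -/
theorem Unprovable.exists_propagated {X : Set ℕ} (hX : X ⊆ {n : ℕ | 1 < n}) {t : SequentTree Atm}
    (ht : t.Unprovable X) {w v : List ℕ} {A F : Formula Atm} (hA : t.Has w A.dia)
    (hv : Dom (w ++ v) t) (hF : Propagates X A v.length F) :
    ∃ t', t ≤ t' ∧ t'.Unprovable X ∧ t'.Sat (w ++ v) F := by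
  -- Since every n ∈ X exceeds 1, the path is nonempty and ◇A lies outside the chain.
  have hne : v ≠ [] := by
    rintro rfl
    rcases hF with ⟨-, h⟩ | ⟨-, h⟩
    · simp at h
    · exact absurd (hX h) (by simp)
  have hs : (modify (addRoot F) (w ++ v) t).Sat (w ++ v) F := by
    refine Has.sat ⟨dom_modify_self _ hv, ?_⟩
    rw [get_modify_self]
    exact Multiset.mem_cons_self F _
  refine ⟨modify (addRoot F) (w ++ v) t, Extends.le (F := F) (w := w ++ v) ?_ hs, ?_, hs⟩
  · exact .modify (extends_root le_rfl (fun _ _ => rfl) fun B hB =>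
      Or.inl (Multiset.mem_cons_of_mem hB))
  obtain ⟨hw, hv⟩ := (dom_append w v t).1 hv
  obtain ⟨C, h₁, h₂⟩ := exists_context hw
  obtain ⟨Γ, Δs, hl, h₃, h₄, h₅⟩ := exists_chain hv
  obtain ⟨Θ, rfl⟩ := h₅ hne
  obtain ⟨M, hM⟩ := Multiset.exists_cons_of_mem hA.2
  have key : ∀ Λ, C.fill (ofMultiset (get w t).root + Θ + Λ) =
      (C.addHole (ofMultiset M + Θ)).fill (ofFormula A.dia + Λ) := by
    intro Λ
    rw [Context.addHole_fill, hM, ofMultiset_cons]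
    congr 1
    abel
  intro hp
  rw [modify_append, h₂, h₄, key] at hp
  apply ht
  rw [h₁, h₃, key]
  rcases hF with ⟨rfl, hm⟩ | ⟨rfl, hm⟩
  · obtain ⟨Δ, rfl⟩ := List.length_eq_one_iff.1 (hl.trans hm)
    simp only [chain, add_zero] at hp ⊢
    refine .infer (Or.inl (NKRule.dia _ F Δ)) ?_
    rw [add_comm Δ] at hp
    simpa using hp
  · refine .infer (Or.inr (Set.mem_biUnion hm ⟨_, A, Δs, by rw [hl], rfl⟩)) ?_
    simpa using hp

end SequentTree

/-! ### Saturated sets from generic ideals. -/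

open SequentTree

/-- A set of labelled formulas on a tree of labels that is closed under the rules read upwards. -/
structure Saturated (X : Set ℕ) (D : List ℕ → Prop) (T : List ℕ → Formula Atm → Prop) : Prop where
  dom_prefix : ∀ w v, D (w ++ v) → D w
  atom : ∀ w p, T w (atom p) → ¬ T w (natom p)
  and : ∀ w A B, T w (.and A B) → T w A ∨ T w B
  or : ∀ w A B, T w (.or A B) → T w A ∧ T w B
  box : ∀ w A, T w (.box A) → ∃ i, D (w ++ [i]) ∧ T (w ++ [i]) A
  dia : ∀ w v A F, T w (.dia A) → D (w ++ v) → Propagates X A v.length F → T (w ++ v) F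

/-- The demands are decompositions (left summand) and propagations (right summand). Facts from
different trees of the ideal meet in a common extension; this also excludes p and p̄ at one label,
as that extension would be an axiom. -/
theorem exists_saturated [Countable Atm] {X : Set ℕ} (hX : X ⊆ {n : ℕ | 1 < n}) {A : Formula Atm}
    (hA : ¬ Provable (nK Atm ∪ dia4Set Atm X) (ofFormula A)) :
    ∃ D T, Saturated X D T ∧ T [] A := by
  let P := {t : SequentTree Atm // t.Unprovable X}
  let ι := (List ℕ × Formula Atm) ⊕
    {q : List ℕ × List ℕ × Formula Atm × Formula Atm // Propagates X q.2.2.1 q.2.1.length q.2.2.2}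
  let a : ι → P → Prop := Sum.elim (fun q s => s.1.Sat q.1 q.2)
    fun q s => s.1.Sat q.1.1 q.1.2.2.1.dia ∧ Dom (q.1.1 ++ q.1.2.1) s.1
  let b : ι → P → Prop := Sum.elim (fun q s => s.1.Decomposed q.1 q.2)
    fun q s => s.1.Sat (q.1.1 ++ q.1.2.1) q.1.2.2.2
  have hle : ∀ {s s' : P}, s ≤ s' → s.1 ≤ s'.1 := fun h => h
  obtain ⟨I, hI, hI'⟩ := exists_ideal_answering a b (by
    rintro (q | q) s s' h hs
    · exact (hle h).2 _ _ hs
    · exact ⟨(hle h).2 _ _ hs.1, (hle h).1 _ hs.2⟩) (by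
    rintro (q | q) s hs
    · obtain ⟨t, h₁, h₂, h₃⟩ := s.2.exists_decomposed hs
      exact ⟨⟨t, h₂⟩, h₁, h₃⟩
    · obtain ⟨t, h₁, h₂, h₃⟩ := s.2.exists_propagated hX hs.1 hs.2 q.2
      exact ⟨⟨t, h₂⟩, h₁, h₃⟩)
    (⟨node {A} 0 fun _ => nil, by
      rwa [Unprovable, toSequent, Finset.range_zero, Finset.sum_empty, add_zero,
        ofMultiset_singleton]⟩ : P)
  have hdec : ∀ w F, (∃ s ∈ I, s.1.Sat w F) → ∃ s ∈ I, s.1.Decomposed w F := by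
    rintro w F ⟨s, hs, h⟩
    exact hI' (Sum.inl (w, F)) s hs h
  refine ⟨fun w => ∃ s ∈ I, Dom w s.1, fun w F => ∃ s ∈ I, s.1.Sat w F,
    ⟨?_, ?_, ?_, ?_, ?_, ?_⟩, _, hI, ?_⟩
  · rintro w v ⟨s, hs, h⟩
    exact ⟨s, hs, ((dom_append w v _).1 h).1⟩
  · rintro w p ⟨s₁, hs₁, h₁⟩ ⟨s₂, hs₂, h₂⟩
    obtain ⟨s, _, hs₁', hs₂'⟩ := I.directed s₁ hs₁ s₂ hs₂
    have h₁' : s.1.Has w (.atom p) := (hle hs₁').2 _ _ h₁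
    have h₂' : s.1.Has w (.natom p) := (hle hs₂').2 _ _ h₂
    obtain ⟨C, hC⟩ := h₁'.exists_decomposition₂ (by simp) h₂'
    apply s.2
    rw [hC]
    exact .infer (Or.inl (NKRule.id C p)) (by simp)
  · intro w A B h
    obtain ⟨s, hs, h⟩ := hdec w _ h
    exact h.imp (fun h => ⟨s, hs, h⟩) fun h => ⟨s, hs, h⟩
  · intro w A B h
    obtain ⟨s, hs, h⟩ := hdec w _ h
    exact h.imp (fun h => ⟨s, hs, h⟩) fun h => ⟨s, hs, h⟩
  · intro w A h
    obtain ⟨s, hs, i, h₁, h₂⟩ := hdec w _ h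
    exact ⟨i, ⟨s, hs, h₁⟩, s, hs, h₂⟩
  · rintro w v A F ⟨s₁, hs₁, h₁⟩ ⟨s₂, hs₂, h₂⟩ hF
    obtain ⟨s, hs, hs₁', hs₂'⟩ := I.directed s₁ hs₁ s₂ hs₂
    exact hI' (Sum.inr ⟨(w, v, A, F), hF⟩) s hs ⟨(hle hs₁').2 _ _ h₁, (hle hs₂').1 _ h₂⟩
  · exact Has.sat ⟨trivial, Multiset.mem_singleton_self A⟩

/-! ### The countermodel on a saturated tree. -/

/-- The lengths, less one, of the paths that the frame conditions `Rⁿ ⊆ R` for `n ∈ X` shorten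
to a single step. -/
def excess (X : Set ℕ) : AddSubmonoid ℕ := AddSubmonoid.closure {m | m + 1 ∈ X}

/-- Accessibility in the model on a tree of labels. -/
def TreeRel (X : Set ℕ) (D : List ℕ → Prop) (w u : List ℕ) : Prop :=
  D u ∧ ∃ v, u = w ++ v ∧ ∃ s ∈ excess X, v.length = s + 1

/-- A step of excess s descends s + 1 levels, so n + 1 steps descend the sum of their excesses plus
n + 1. -/
theorem RelPow.exists_append {X : Set ℕ} {D : List ℕ → Prop} {n : ℕ} {w u : List ℕ}
    (h : RelPow (TreeRel X D) (n + 1) w u) :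
    D u ∧ ∃ v, u = w ++ v ∧ ∃ s ∈ excess X, v.length = s + (n + 1) := by
  induction n generalizing w with
  | zero =>
    obtain ⟨_, h, rfl⟩ := h
    exact h
  | succ n ih =>
    obtain ⟨_, ⟨-, v, rfl, s, hs, hl⟩, h⟩ := h
    obtain ⟨hu, v', rfl, s', hs', hl'⟩ := ih h
    refine ⟨hu, v ++ v', by simp, s + s', add_mem hs hs', ?_⟩
    rw [List.length_append, hl, hl']
    omega

/-- Seen as a single step, a path of n steps has the sum of their excesses plus n - 1 as its excess,
and n - 1 is a generator. -/
theorem TreeRel.of_relPow {X : Set ℕ} (hX : X ⊆ {n : ℕ | 1 < n}) {D : List ℕ → Prop} {n : ℕ}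
    (hn : n ∈ X) {w u : List ℕ} (h : RelPow (TreeRel X D) n w u) : TreeRel X D w u := by
  obtain ⟨m, rfl⟩ : ∃ m, n = m + 1 := ⟨n - 1, by have := hX hn; simp at this; omega⟩
  obtain ⟨hu, v, rfl, s, hs, hl⟩ := h.exists_append
  refine ⟨hu, v, rfl, s + m, add_mem hs (AddSubmonoid.subset_closure hn), ?_⟩
  omega

namespace Saturated

variable {X : Set ℕ} {D : List ℕ → Prop} {T : List ℕ → Formula Atm → Prop}

/-- Each generator n - 1 is one use of propagation by ◇₄ₙ. A sum splits the path, and the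
intermediate label exists because labels are closed under prefixes. -/
theorem dia_of_excess (h : Saturated X D T) {A : Formula Atm} {s : ℕ} (hs : s ∈ excess X)
    {w v : List ℕ} (hv : v.length = s) (hD : D (w ++ v)) (hA : T w A.dia) : T (w ++ v) A.dia := by
  induction hs using AddSubmonoid.closure_induction generalizing w v with
  | mem m hm => exact h.dia w v A _ hA hD (Or.inr ⟨rfl, by rw [hv]; exact hm⟩)
  | zero =>
    obtain rfl := List.length_eq_zero_iff.1 hv
    simpa using hA
  | add m n _ _ ihm ihn =>
    rw [← List.take_append_drop m v, ← List.append_assoc] at hD ⊢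
    refine ihn (by simp [hv]) hD (ihm (by simp [hv]) (h.dom_prefix _ _ hD) hA)

theorem not_forces (h : Saturated X D T) {w : List ℕ} {A : Formula Atm} (hA : T w A) :
    ¬ Forces (TreeRel X D) (fun p w => ¬ T w (.atom p)) w A := by
  induction A generalizing w with
  | atom p => exact fun h' => h' hA
  | natom p => exact fun h' => h' fun h'' => h.atom w p h'' hA
  | and A B ihA ihB =>
    rintro ⟨h₁, h₂⟩
    exact (h.and w A B hA).elim (fun h => ihA h h₁) fun h => ihB h h₂
  | or A B ihA ihB =>
    rintro (h' | h')
    · exact ihA (h.or w A B hA).1 h'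
    · exact ihB (h.or w A B hA).2 h'
  | box A ih =>
    intro h'
    obtain ⟨i, hi, hA⟩ := h.box w A hA
    exact ih hA (h' _ ⟨hi, [i], rfl, 0, zero_mem _, rfl⟩)
  | dia A ih =>
    rintro ⟨_, ⟨hD, v, rfl, s, hs, hl⟩, h'⟩
    -- The path has length s + 1: ◇A travels the first s levels, and the last level is an ordinary ◇
    -- step to A.
    rw [← List.take_append_drop s v, ← List.append_assoc] at hD h'
    exact ih (h.dia _ _ A A (h.dia_of_excess hs (by simp [hl]) (h.dom_prefix _ _ hD) hA) hD
      (Or.inl ⟨rfl, by simp [hl]⟩)) h'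

end Saturated

/-- Every theorem of the Hilbert system has a cut-free proof. -/
theorem KTheorem.provable [Countable Atm] {X : Set ℕ} (hX : X ⊆ {n : ℕ | 1 < n})
    {A : Formula Atm} (h : KTheorem (quasiTransAxioms Atm X) A) :
    Provable (nK Atm ∪ dia4Set Atm X) (ofFormula A) := by
  by_contra hA
  obtain ⟨D, T, hT, hA⟩ := exists_saturated hX hA
  exact hT.not_forces hA (h.forces _ _ (fun _ hn _ _ => TreeRel.of_relPow hX hn) [])

end QuasiTrans

theorem theorem3 {Atm : Type*} [Countable Atm] (X : Set ℕ) (hX : X ⊆ {n : ℕ | 1 < n})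
    (A : QuasiTrans.Formula Atm) :
    QuasiTrans.KTheorem (QuasiTrans.quasiTransAxioms Atm X) A ↔
      QuasiTrans.Provable (QuasiTrans.nK Atm ∪ QuasiTrans.dia4Set Atm X)
        (QuasiTrans.NSequent.ofFormula A) :=
  ⟨fun h => h.provable hX, fun h => h.kTheorem⟩
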